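/- Let $A\subset\mathbb{R}^d$ be a finite set with $|A|=m$ that is proper $d$-dimensional, that is, not contained in any affine hyperplane of $\mathbb{R}^d$. Let $A'=\operatorname{vert}A$ be the set of vertices of $A$, that is, of those points $a\in A$ that do not lie in the convex hull of $A\setminus\{a\}$. Then $$|A+A'|\ \ge\ m(d+1)-\frac{d(d+1)}{2},$$ where $A+A'=\{a+a' : a\in A,\ a'\in A'\}$. -/

import Mathlib

open scoped Pointwise

/-- A subset of `ℝ^d` is proper `d`-dimensional if it is not contained in any affine hyperplane,
an affine hyperplane being a set `{x | f x = c}` with `f` a nonzero linear functional. -/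
def IsProperDim {d : ℕ} (A : Set (EuclideanSpace ℝ (Fin d))) : Prop :=
  ∀ (f : EuclideanSpace ℝ (Fin d) →ₗ[ℝ] ℝ) (c : ℝ), f ≠ 0 → ¬ A ⊆ {x | f x = c}

/-- The vertices of `A`: the points `a ∈ A` that are not in the convex hull of `A \ {a}`. -/
def vert {d : ℕ} (A : Set (EuclideanSpace ℝ (Fin d))) : Set (EuclideanSpace ℝ (Fin d)) :=
  {a | a ∈ A ∧ a ∉ convexHull ℝ (A \ {a})}

/-! Let V = vert A, so that A lies in conv V. Heights on V induce a regular subdivision of conv V.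
Pair each x in A with at least d+1 vertices s of a cell containing x. If x + s = x' + s', this point
is represented by two weight systems of least height. For generic heights they agree, so the pairs
are equal or swapped: x = s' and x' = s (`GenericHeights.eq_or_swap`).

Swaps are controlled by placing the vertices in order. An initial simplex loses C(d+1,2) pairs. Each
further vertex is lifted high enough to preserve the old cells (`GenericHeights.exists_insert`). The
points newly covered lie outside the old hull and include at most one vertex, so they lose nothing.
This leaves m(d+1) - d(d+1)/2 distinct sums. -/

variable {E : Type*} [NormedAddCommGroup E] [NormedSpace ℝ E]

/-! ### Lower supports and the cells they cut out -/

/-- The affine function `v ↦ φ v + α` lies below the heights `w` on `V`. -/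
def LowerSupport (V : Finset E) (w : E → ℝ) (φ : E →L[ℝ] ℝ) (α : ℝ) : Prop :=
  ∀ v ∈ V, φ v + α ≤ w v

open Classical in
/-- The points of `V` at which the affine function `v ↦ φ v + α` attains the height `w`. -/
noncomputable def tight (V : Finset E) (w : E → ℝ) (φ : E →L[ℝ] ℝ) (α : ℝ) : Finset E :=
  V.filter fun v => φ v + α = w v

theorem mem_tight {V : Finset E} {w : E → ℝ} {φ : E →L[ℝ] ℝ} {α : ℝ} {v : E} :
    v ∈ tight V w φ α ↔ v ∈ V ∧ φ v + α = w v := by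
  simp [tight]

theorem tight_subset (V : Finset E) (w : E → ℝ) (φ : E →L[ℝ] ℝ) (α : ℝ) :
    tight V w φ α ⊆ V := fun _ h => (mem_tight.1 h).1

theorem apply_add_le_of_mem_convexHull {V : Set E} {φ : E →L[ℝ] ℝ} {α M : ℝ}
    (h : ∀ v ∈ V, φ v + α ≤ M) {y : E} (hy : y ∈ convexHull ℝ V) : φ y + α ≤ M := by
  have hc : Convex ℝ {y : E | φ y ≤ M - α} := convex_halfSpace_le φ.toLinearMap.isLinear _
  have := convexHull_min (fun v hv => by simpa using le_sub_iff_add_le.2 (h v hv)) hc hy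
  simp only [Set.mem_ofPred_eq] at this
  linarith

/-- The lower supports whose value at an interior point is bounded below form a compact set,
hence one of them maximizes the value at that point. -/
theorem exists_lowerSupport_isMax [FiniteDimensional ℝ E] (V : Finset E) (w : E → ℝ) {x : E}
    (hx : x ∈ interior (convexHull ℝ (V : Set E))) :
    ∃ (φ : E →L[ℝ] ℝ) (α : ℝ), LowerSupport V w φ α ∧
      ∀ ψ β, LowerSupport V w ψ β → ψ x + β ≤ φ x + α := by
  obtain ⟨M, hM⟩ : ∃ M, ∀ v ∈ V, w v ≤ M := by
    obtain ⟨M, hM⟩ := (V.finite_toSet.image w).bddAbove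
    exact ⟨M, fun v hv => hM ⟨v, hv, rfl⟩⟩
  obtain ⟨m, hm⟩ : ∃ m, ∀ v ∈ V, m ≤ w v := by
    obtain ⟨m, hm⟩ := (V.finite_toSet.image w).bddBelow
    exact ⟨m, fun v hv => hm ⟨v, hv, rfl⟩⟩
  obtain ⟨r, hr, hball⟩ := Metric.nhds_basis_closedBall.mem_iff.1 (mem_interior_iff_mem_nhds.1 hx)
  -- Here `p.2` is the value of the support at `x`, not its constant term; a ball around `x` inside
  -- the hull then bounds the slope.
  set Q : Set ((E →L[ℝ] ℝ) × ℝ) := {p | (∀ v ∈ V, p.1 (v - x) + p.2 ≤ w v) ∧ m ≤ p.2} with hQ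
  have hup : ∀ p ∈ Q, ∀ u ∈ Metric.closedBall (0 : E) r, p.1 u + p.2 ≤ M := by
    intro p hp u hu
    have hu' : x + u ∈ convexHull ℝ (V : Set E) := hball (by simpa using hu)
    have := apply_add_le_of_mem_convexHull (φ := p.1) (α := p.2 - p.1 x) (M := M)
      (fun v hv => by have := hp.1 v hv; rw [map_sub] at this; linarith [hM v hv]) hu'
    rw [map_add] at this
    linarith
  have hsub : Q ⊆ Metric.closedBall (0 : E →L[ℝ] ℝ) ((M - m) / r) ×ˢ Set.Icc m M := by
    intro p hp
    refine ⟨?_, hp.2, by simpa using hup p hp 0 (by simpa using hr.le)⟩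
    rw [mem_closedBall_zero_iff]
    refine ContinuousLinearMap.opNorm_bound_of_ball_bound hr _ _ fun z hz => ?_
    have h1 := hup p hp z hz
    have h2 := hup p hp (-z) (by simpa using hz)
    rw [map_neg] at h2
    rw [Real.norm_eq_abs, abs_le]
    constructor <;> linarith [hp.2]
  have hclosed : IsClosed Q := by
    have : Q = (⋂ v ∈ V, {p | p.1 (v - x) + p.2 ≤ w v}) ∩ {p | m ≤ p.2} := by
      ext p; simp [hQ]
    rw [this]
    refine IsClosed.inter (isClosed_biInter fun v _ => isClosed_le ?_ continuous_const)
      (isClosed_le continuous_const continuous_snd)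
    fun_prop
  have hcompact : IsCompact Q :=
    ((isCompact_closedBall _ _).prod isCompact_Icc).of_isClosed_subset hclosed hsub
  obtain ⟨p, hp, hmax⟩ := hcompact.exists_isMaxOn ⟨(0, m), by simpa [hQ] using hm⟩
    (continuous_snd.continuousOn)
  refine ⟨p.1, p.2 - p.1 x, fun v hv => ?_, fun ψ β h => ?_⟩
  · have := hp.1 v hv
    rw [map_sub] at this
    linarith
  · by_cases hβ : m ≤ ψ x + β
    · have := hmax (a := (ψ, ψ x + β)) ⟨fun v hv => by
        have := h v hv; rw [map_sub]; linarith, hβ⟩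
      simp only [Set.mem_ofPred_eq] at this
      linarith
    · linarith [hp.2]

/-- If the hull of the tight points missed `x`, tilting the optimal support along a separating
functional would raise its value at `x`. -/
theorem exists_lowerSupport_mem_convexHull_tight [FiniteDimensional ℝ E] (V : Finset E)
    (w : E → ℝ) {x : E} (hx : x ∈ interior (convexHull ℝ (V : Set E))) :
    ∃ (φ : E →L[ℝ] ℝ) (α : ℝ), LowerSupport V w φ α ∧
      x ∈ convexHull ℝ (tight V w φ α : Set E) := by
  obtain ⟨φ, α, hφ, hmax⟩ := exists_lowerSupport_isMax V w hx
  refine ⟨φ, α, hφ, ?_⟩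
  by_contra hnot
  obtain ⟨f, u, hfx, hft⟩ := geometric_hahn_banach_point_closed (convex_convexHull ℝ _)
    ((tight V w φ α).finite_toSet.isClosed_convexHull ℝ) hnot
  -- The tilt lowers the support at tight points, and the other points have slack.
  have key : ∃ ε : ℝ, 0 < ε ∧ ∀ v ∈ V, φ v + α + ε * (u - f v) ≤ w v := by
    have hev : ∀ v ∈ V, ∀ᶠ ε : ℝ in nhdsWithin 0 (Set.Ioi 0), φ v + α + ε * (u - f v) ≤ w v := by
      intro v hv
      by_cases ht : φ v + α = w v
      · have h1 := hft v (subset_convexHull ℝ _ (mem_tight.2 ⟨hv, ht⟩))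
        filter_upwards [self_mem_nhdsWithin] with ε hε
        have : ε * (u - f v) ≤ 0 := mul_nonpos_of_nonneg_of_nonpos (le_of_lt hε) (by linarith)
        linarith
      · have hlt := lt_of_le_of_ne (hφ v hv) ht
        have hcont : ContinuousAt (fun ε : ℝ => φ v + α + ε * (u - f v)) 0 := by fun_prop
        have := hcont.eventually_lt (continuousAt_const (y := w v)) (by simpa using hlt)
        exact (this.filter_mono nhdsWithin_le_nhds).mono fun _ h => h.le
    obtain ⟨ε, h1, h2⟩ := (((Finset.eventually_all V).2 hev).and self_mem_nhdsWithin).exists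
    exact ⟨ε, h2, h1⟩
  obtain ⟨ε, hε, hle⟩ := key
  have := hmax (φ - ε • f) (α + ε * u) fun v hv => by
    have := hle v hv
    simp only [sub_apply, smul_apply, smul_eq_mul]
    linarith
  simp only [sub_apply, smul_apply, smul_eq_mul] at this
  nlinarith [mul_pos hε (sub_pos.2 hfx)]

/-- Degenerate tight sets only catch points on finitely many proper flats, a null set. The
full-dimensional cells are therefore dense in the hull and, being finitely many closed sets, cover
it, boundary included. -/
theorem exists_lowerSupport_spanning [FiniteDimensional ℝ E] {V : Finset E} (w : E → ℝ)
    (hV : affineSpan ℝ (V : Set E) = ⊤) {x : E} (hx : x ∈ convexHull ℝ (V : Set E)) :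
    ∃ (φ : E →L[ℝ] ℝ) (α : ℝ), LowerSupport V w φ α ∧
      affineSpan ℝ (tight V w φ α : Set E) = ⊤ ∧ x ∈ convexHull ℝ (tight V w φ α : Set E) := by
  classical
  let _ : MeasurableSpace E := borel E
  have : BorelSpace E := ⟨rfl⟩
  let μ : MeasureTheory.Measure E := MeasureTheory.Measure.addHaar
  set N : Set E := ⋃ T ∈ V.powerset.filter (fun T : Finset E => affineSpan ℝ (T : Set E) ≠ ⊤),
    (affineSpan ℝ (T : Set E) : Set E) with hN
  have hN0 : μ N = 0 := by
    rw [hN]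
    refine (MeasureTheory.measure_biUnion_null_iff (Finset.countable_toSet _)).2 fun T hT => ?_
    exact MeasureTheory.Measure.addHaar_affineSubspace _ _ (Finset.mem_filter.1 hT).2
  have hdense : Dense Nᶜ := MeasureTheory.Measure.dense_of_ae (μ := μ)
    (MeasureTheory.measure_eq_zero_iff_ae_notMem.1 hN0)
  set G : Set E := ⋃ T ∈ V.powerset.filter (fun T : Finset E => affineSpan ℝ (T : Set E) = ⊤ ∧
    ∃ φ α, LowerSupport V w φ α ∧ T = tight V w φ α), convexHull ℝ (T : Set E) with hG
  have hGclosed : IsClosed G := by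
    rw [hG]
    exact Set.Finite.isClosed_biUnion (Finset.finite_toSet _) fun T _ =>
      T.finite_toSet.isClosed_convexHull ℝ
  have hsub : interior (convexHull ℝ (V : Set E)) ∩ Nᶜ ⊆ G := by
    rintro y ⟨hy, hyN⟩
    obtain ⟨φ, α, hφ, hyt⟩ := exists_lowerSupport_mem_convexHull_tight V w hy
    have hspan : affineSpan ℝ (tight V w φ α : Set E) = ⊤ := by
      by_contra hne
      refine hyN (Set.mem_biUnion (x := tight V w φ α) ?_ (convexHull_subset_affineSpan _ hyt))
      exact Finset.mem_filter.2 ⟨Finset.mem_powerset.2 (tight_subset ..), hne⟩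
    refine Set.mem_biUnion (x := tight V w φ α) ?_ hyt
    exact Finset.mem_filter.2 ⟨Finset.mem_powerset.2 (tight_subset ..), hspan, φ, α, hφ, rfl⟩
  have hxG : x ∈ G := by
    have h1 : interior (convexHull ℝ (V : Set E)) ⊆ G :=
      (hdense.open_subset_closure_inter isOpen_interior).trans (closure_minimal hsub hGclosed)
    have h2 := (convex_convexHull ℝ (V : Set E)).closure_interior_eq_closure_of_nonempty_interior
      (interior_convexHull_nonempty_iff_affineSpan_eq_top.2 hV)
    exact closure_minimal h1 hGclosed (h2 ▸ subset_closure hx)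
  obtain ⟨T, hT, hxT⟩ := Set.mem_iUnion₂.1 hxG
  obtain ⟨-, hspan, φ, α, hφ, rfl⟩ := Finset.mem_filter.1 hT
  exact ⟨φ, α, hφ, hspan, hxT⟩

theorem finrank_add_one_le_card_of_affineSpan_eq_top [FiniteDimensional ℝ E] {T : Finset E}
    (hT : affineSpan ℝ (T : Set E) = ⊤) : Module.finrank ℝ E + 1 ≤ T.card := by
  classical
  obtain ⟨t, hts, hspan, hind⟩ := exists_affineIndependent ℝ E (T : Set E)
  have : Fintype t := (T.finite_toSet.subset hts).fintype
  have h := (hind.affineSpan_eq_top_iff_card_eq_finrank_add_one).1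
    (by rw [Subtype.range_coe, hspan, hT])
  rw [← h, ← Set.toFinset_card]
  exact Finset.card_le_card fun a ha => by simpa using hts (by simpa using ha)

theorem apply_add_eq_zero_of_affineSpan_eq_top {T : Set E} (hT : affineSpan ℝ T = ⊤)
    {φ : E →L[ℝ] ℝ} {α : ℝ} (h : ∀ u ∈ T, φ u + α = 0) (x : E) : φ x + α = 0 := by
  have hx : x ∈ affineSpan ℝ T := by rw [hT]; trivial
  refine affineSpan_induction (p := fun x => φ x + α = 0) hx h fun c u v w hu hv hw => ?_
  simp only [vsub_eq_sub, vadd_eq_add, map_add, map_smul, map_sub, smul_eq_mul]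
  linear_combination c * hu - c * hv + hw

/-! ### Generic heights and coincidences of sums -/

/-- The heights `w` on `V` are generic if no affine function attains them on the support of a
nontrivial affine dependence. -/
def GenericHeights (V : Finset E) (w : E → ℝ) : Prop :=
  ∀ (φ : E →L[ℝ] ℝ) (α : ℝ) (μ : E → ℝ), (∀ v ∈ V, μ v ≠ 0 → φ v + α = w v) →
    ∑ v ∈ V, μ v = 0 → ∑ v ∈ V, μ v • v = 0 → ∀ v ∈ V, μ v = 0

/-- `x` lies in a cell of the regular subdivision of `V` induced by `w`, and `s` is a vertex of
that cell. -/
def SharesCell (V : Finset E) (w : E → ℝ) (x s : E) : Prop :=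
  ∃ (φ : E →L[ℝ] ℝ) (α : ℝ), LowerSupport V w φ α ∧ affineSpan ℝ (tight V w φ α : Set E) = ⊤ ∧
    x ∈ convexHull ℝ (tight V w φ α : Set E) ∧ s ∈ tight V w φ α

theorem SharesCell.right_mem {V : Finset E} {w : E → ℝ} {x s : E} (h : SharesCell V w x s) :
    s ∈ V := by
  obtain ⟨φ, α, -, -, -, hs⟩ := h
  exact tight_subset _ _ _ _ hs

theorem SharesCell.left_mem {V : Finset E} {w : E → ℝ} {x s : E} (h : SharesCell V w x s) :
    x ∈ convexHull ℝ (V : Set E) := by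
  obtain ⟨φ, α, -, -, hx, -⟩ := h
  exact convexHull_mono (by exact_mod_cast tight_subset _ _ _ _) hx

theorem exists_weights_of_mem_convexHull {V T : Finset E} (hT : T ⊆ V) {x : E}
    (hx : x ∈ convexHull ℝ (T : Set E)) :
    ∃ μ : E → ℝ, (∀ v, 0 ≤ μ v) ∧ (∀ v, μ v ≠ 0 → v ∈ T) ∧ ∑ v ∈ V, μ v = 1 ∧
      ∑ v ∈ V, μ v • v = x := by
  classical
  obtain ⟨μ, h0, h1, h2⟩ := Finset.mem_convexHull'.1 hx
  refine ⟨fun v => if v ∈ T then μ v else 0, fun v => ?_, fun v hv => ?_, ?_, ?_⟩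
  · dsimp only
    split_ifs with h
    exacts [h0 v h, le_rfl]
  · by_contra h
    simp [h] at hv
  · rw [← h1, Finset.sum_ite_mem, Finset.inter_eq_right.2 hT]
  · rw [← h2]
    simp only [ite_smul, zero_smul]
    rw [Finset.sum_ite_mem, Finset.inter_eq_right.2 hT]

theorem sum_mul_apply_add (V : Finset E) (μ : E → ℝ) (φ : E →L[ℝ] ℝ) (α : ℝ) :
    ∑ v ∈ V, μ v * (φ v + α) = φ (∑ v ∈ V, μ v • v) + (∑ v ∈ V, μ v) * α := by
  simp only [map_sum, map_smul, smul_eq_mul, mul_add, Finset.sum_add_distrib, Finset.sum_mul]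

/-- Two weight systems with equal total and barycenter, each supported on the tight set of some
lower support, coincide when the heights are generic. -/
theorem GenericHeights.weights_eq {V : Finset E} {w : E → ℝ} (hw : GenericHeights V w)
    {φ φ' : E →L[ℝ] ℝ} {α α' : ℝ} (hφ : LowerSupport V w φ α) (hφ' : LowerSupport V w φ' α')
    {μ μ' : E → ℝ} (hμ : ∀ v ∈ V, 0 ≤ μ v) (hμ' : ∀ v ∈ V, 0 ≤ μ' v)
    (ht : ∀ v ∈ V, μ v ≠ 0 → φ v + α = w v) (ht' : ∀ v ∈ V, μ' v ≠ 0 → φ' v + α' = w v)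
    (hsum : ∑ v ∈ V, μ v = ∑ v ∈ V, μ' v) (hbar : ∑ v ∈ V, μ v • v = ∑ v ∈ V, μ' v • v) :
    ∀ v ∈ V, μ v = μ' v := by
  have e1 : ∑ v ∈ V, μ v * w v = ∑ v ∈ V, μ v * (φ v + α) := Finset.sum_congr rfl fun v hv => by
    by_cases h : μ v = 0
    · simp [h]
    · rw [ht v hv h]
  have e2 : ∑ v ∈ V, μ' v * w v = ∑ v ∈ V, μ' v * (φ' v + α') :=
    Finset.sum_congr rfl fun v hv => by
      by_cases h : μ' v = 0
      · simp [h]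
      · rw [ht' v hv h]
  have e3 : ∑ v ∈ V, μ v * (φ' v + α') ≤ ∑ v ∈ V, μ v * w v :=
    Finset.sum_le_sum fun v hv => mul_le_mul_of_nonneg_left (hφ' v hv) (hμ v hv)
  have e4 : ∀ v ∈ V, 0 ≤ μ' v * (w v - (φ v + α)) := fun v hv =>
    mul_nonneg (hμ' v hv) (sub_nonneg.2 (hφ v hv))
  -- Complementary slackness: by `e1`, `e2`, `e3` the total height of `μ'` is at most that of `μ`,
  -- which `φ` and `α` compute from the common total and barycenter.
  have e5 : ∑ v ∈ V, μ' v * (w v - (φ v + α)) = 0 := by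
    refine le_antisymm ?_ (Finset.sum_nonneg e4)
    simp only [mul_sub, Finset.sum_sub_distrib]
    rw [sum_mul_apply_add, hsum, hbar] at e1 e3
    rw [sum_mul_apply_add] at e2 ⊢
    linarith
  have ht'' : ∀ v ∈ V, μ' v ≠ 0 → φ v + α = w v := fun v hv h => by
    have := (Finset.sum_eq_zero_iff_of_nonneg e4).1 e5 v hv
    have := (mul_eq_zero.1 this).resolve_left h
    linarith
  intro v hv
  have := hw φ α (fun v => μ v - μ' v) (fun v hv h => ?_) ?_ ?_ v hv
  · exact sub_eq_zero.1 this
  · by_cases h0 : μ v = 0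
    · exact ht'' v hv fun h1 => h (by simp [h0, h1])
    · exact ht v hv h0
  · rw [Finset.sum_sub_distrib, hsum, sub_self]
  · simp only [sub_smul]
    rw [Finset.sum_sub_distrib, hbar, sub_self]

/-- Adding unit mass at `s` to convex weights for `x` keeps them on one tight set, so `weights_eq`
applies. If `s ≠ s'`, the weights of `x` must put mass 1 on `s'`. -/
theorem GenericHeights.eq_or_swap {V : Finset E} {w : E → ℝ} (hw : GenericHeights V w)
    {x s x' s' : E} (h : SharesCell V w x s) (h' : SharesCell V w x' s') (heq : x + s = x' + s') :
    (x = x' ∧ s = s') ∨ (x = s' ∧ x' = s) := by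
  classical
  have hsV := h.right_mem
  have hsV' := h'.right_mem
  obtain ⟨φ, α, hφ, -, hx, hs⟩ := h
  obtain ⟨φ', α', hφ', -, hx', hs'⟩ := h'
  obtain ⟨μ, h0, ht, h1, h2⟩ := exists_weights_of_mem_convexHull (tight_subset V w φ α) hx
  obtain ⟨μ', h0', ht', h1', h2'⟩ := exists_weights_of_mem_convexHull (tight_subset V w φ' α') hx'
  by_cases hss : s = s'
  · subst hss
    exact Or.inl ⟨add_right_cancel heq, rfl⟩
  have key := hw.weights_eq hφ hφ' (μ := fun v => μ v + if v = s then 1 else 0)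
    (μ' := fun v => μ' v + if v = s' then 1 else 0)
    (fun v _ => add_nonneg (h0 v) (by split_ifs <;> norm_num))
    (fun v _ => add_nonneg (h0' v) (by split_ifs <;> norm_num))
    (fun v hv hne => ?_) (fun v hv hne => ?_) ?_ ?_ s' hsV'
  · have hone : 1 ≤ μ s' := by
      simp only [if_neg (Ne.symm hss), if_true] at key
      linarith [h0' s']
    have hsplit := Finset.add_sum_erase V μ hsV'
    have hrest : ∀ v ∈ V.erase s', μ v = 0 :=
      (Finset.sum_eq_zero_iff_of_nonneg fun v _ => h0 v).1 (le_antisymm (by linarith)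
        (Finset.sum_nonneg fun v _ => h0 v))
    have hμ : μ s' = 1 := by
      rw [Finset.sum_eq_zero hrest] at hsplit
      linarith
    have hxs : x = s' := by
      rw [← h2, ← Finset.add_sum_erase V _ hsV', hμ, one_smul,
        Finset.sum_eq_zero fun v hv => by rw [hrest v hv, zero_smul], add_zero]
    refine Or.inr ⟨hxs, ?_⟩
    rw [hxs, add_comm] at heq
    exact (add_right_cancel heq).symm
  · by_cases hv0 : v = s
    · exact hv0 ▸ (mem_tight.1 hs).2
    · exact (mem_tight.1 (ht v (by simpa [hv0] using hne))).2
  · by_cases hv0 : v = s'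
    · exact hv0 ▸ (mem_tight.1 hs').2
    · exact (mem_tight.1 (ht' v (by simpa [hv0] using hne))).2
  · simp [Finset.sum_add_distrib, h1, h1', hsV, hsV']
  · simp [add_smul, Finset.sum_add_distrib, h2, h2', hsV, hsV', heq]

/-! ### Placing a new point -/

/-- The values at `v` of affine functions attaining `w` on a subset of `V` that determines their
value at `v` are bounded above. -/
theorem exists_gt_determined (V : Finset E) (w : E → ℝ) (v : E) :
    ∃ M : ℝ, ∀ T ⊆ V, (∀ (ψ : E →L[ℝ] ℝ) (β : ℝ), (∀ u ∈ T, ψ u + β = 0) → ψ v + β = 0) →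
      ∀ (φ : E →L[ℝ] ℝ) (α : ℝ), (∀ u ∈ T, φ u + α = w u) → φ v + α < M := by
  classical
  -- Each `T` contributes at most one value, so only finitely many values occur.
  set S : Finset E → Set ℝ := fun T => {c | (∀ (ψ : E →L[ℝ] ℝ) (β : ℝ),
    (∀ u ∈ T, ψ u + β = 0) → ψ v + β = 0) ∧
      ∃ (φ : E →L[ℝ] ℝ) (α : ℝ), (∀ u ∈ T, φ u + α = w u) ∧ c = φ v + α} with hS
  have hsub : ∀ T, (S T).Subsingleton := by
    rintro T c ⟨hdet, φ, α, h, rfl⟩ c' ⟨-, φ', α', h', rfl⟩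
    have := hdet (φ - φ') (α - α') fun u hu => by
      have := h u hu
      have := h' u hu
      simp only [sub_apply]
      linarith
    simp only [sub_apply] at this
    linarith
  have hfin : (⋃ T ∈ V.powerset, S T).Finite :=
    Set.Finite.biUnion (Finset.finite_toSet _) fun T _ => (hsub T).finite
  obtain ⟨M, hM⟩ := hfin.bddAbove
  refine ⟨M + 1, fun T hT hdet φ α h => ?_⟩
  have := hM (Set.mem_biUnion (x := T) (Finset.mem_coe.2 (Finset.mem_powerset.2 hT))
    (show φ v + α ∈ S T from ⟨hdet, φ, α, h, rfl⟩))
  linarith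

open Classical in
/-- A new point can be placed high enough to keep the heights generic and the old cells intact. -/
theorem GenericHeights.exists_insert {V : Finset E} {w : E → ℝ} (hw : GenericHeights V w) {v : E}
    (hv : v ∉ V) : ∃ w' : E → ℝ, GenericHeights (insert v V) w' ∧
      ∀ x s, SharesCell V w x s → SharesCell (insert v V) w' x s := by
  obtain ⟨M, hM⟩ := exists_gt_determined V w v
  have hne : ∀ u ∈ V, u ≠ v := fun u hu h => hv (h ▸ hu)
  have hup : ∀ u ∈ V, Function.update w v M u = w u := fun u hu =>
    Function.update_of_ne (hne u hu) _ _
  refine ⟨Function.update w v M, ?_, ?_⟩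
  · intro φ α μ ht hsum hbar
    rw [Finset.sum_insert hv] at hsum hbar
    have ht0 : ∀ u ∈ V, μ u ≠ 0 → φ u + α = w u := fun u hu h => by
      rw [ht u (Finset.mem_insert_of_mem hu) h, hup u hu]
    by_cases hμv : μ v = 0
    · simp only [hμv, zero_add, zero_smul] at hsum hbar
      intro u hu
      rcases Finset.mem_insert.1 hu with rfl | hu
      · exact hμv
      · exact hw φ α μ ht0 hsum hbar u hu
    · exfalso
      have h1 := ht v (Finset.mem_insert_self _ _) hμv
      rw [Function.update_self] at h1
      -- Since `μ v ≠ 0`, the rest of the dependence determines affine functions at `v`, forcing a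
      -- value below `M`.
      refine (hM (V.filter fun u => μ u ≠ 0) (Finset.filter_subset _ _) (fun ψ β h => ?_) φ α
        fun u hu => ?_).ne h1
      · have hz : ∑ u ∈ V, μ u * (ψ u + β) = 0 := Finset.sum_eq_zero fun u hu => by
          by_cases h0 : μ u = 0
          · simp [h0]
          · rw [h u (Finset.mem_filter.2 ⟨hu, h0⟩), mul_zero]
        rw [sum_mul_apply_add] at hz
        have hb : ψ (∑ u ∈ V, μ u • u) = -(μ v * ψ v) := by
          rw [← neg_eq_of_add_eq_zero_right hbar, map_neg, map_smul, smul_eq_mul]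
        rw [hb] at hz
        have hprod : μ v * (ψ v + β) = 0 := by linear_combination -hz + β * hsum
        exact (mul_eq_zero.1 hprod).resolve_left hμv
      · obtain ⟨hu, h0⟩ := Finset.mem_filter.1 hu
        exact ht0 u hu h0
  · rintro x s ⟨φ, α, hφ, hspan, hx, hs⟩
    -- A spanning tight set determines its support everywhere, so the new point lies strictly above
    -- it.
    have hlt : φ v + α < M := hM _ (tight_subset V w φ α)
      (fun ψ β h => apply_add_eq_zero_of_affineSpan_eq_top hspan (by simpa using h) v) φ α
      fun u hu => (mem_tight.1 hu).2
    have heq : tight (insert v V) (Function.update w v M) φ α = tight V w φ α := by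
      ext u
      simp only [mem_tight, Finset.mem_insert]
      constructor
      · rintro ⟨rfl | hu, h⟩
        · rw [Function.update_self] at h
          exact absurd h hlt.ne
        · exact ⟨hu, by rwa [hup u hu] at h⟩
      · rintro ⟨hu, h⟩
        exact ⟨Or.inr hu, by rwa [hup u hu]⟩
    refine ⟨φ, α, fun u hu => ?_, heq ▸ hspan, heq ▸ hx, heq ▸ hs⟩
    rcases Finset.mem_insert.1 hu with rfl | hu
    · rw [Function.update_self]
      exact hlt.le
    · rw [hup u hu]
      exact hφ u hu

/-! ### Counting distinct sums -/

theorem genericHeights_zero_of_affineIndependent {T : Finset E}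
    (hT : AffineIndependent ℝ (Subtype.val : T → E)) : GenericHeights T 0 := by
  intro φ α μ _ hsum hbar v hv
  refine affineIndependent_iff.1 hT Finset.univ (fun u => μ u) ?_ ?_ ⟨v, hv⟩ (Finset.mem_univ _)
  · rw [Finset.sum_coe_sort T μ, hsum]
  · rw [Finset.sum_coe_sort T fun u => μ u • u, hbar]

theorem sharesCell_zero {T : Finset E} (hT : affineSpan ℝ (T : Set E) = ⊤) {x s : E}
    (hx : x ∈ convexHull ℝ (T : Set E)) (hs : s ∈ T) : SharesCell T 0 x s := by
  have h : tight T 0 (0 : E →L[ℝ] ℝ) 0 = T := by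
    ext v
    simp [mem_tight]
  exact ⟨0, 0, fun v _ => by simp, h.symm ▸ hT, h.symm ▸ hx, h.symm ▸ hs⟩

theorem exists_sharesCell [FiniteDimensional ℝ E] {V : Finset E} (w : E → ℝ)
    (hV : affineSpan ℝ (V : Set E) = ⊤) {x : E} (hx : x ∈ convexHull ℝ (V : Set E)) :
    ∃ S : Finset E, Module.finrank ℝ E + 1 ≤ S.card ∧ ∀ s ∈ S, SharesCell V w x s := by
  obtain ⟨φ, α, hφ, hspan, hxt⟩ := exists_lowerSupport_spanning w hV hx
  exact ⟨_, finrank_add_one_le_card_of_affineSpan_eq_top hspan,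
    fun s hs => ⟨φ, α, hφ, hspan, hxt, hs⟩⟩

theorem card_filter_lt_le_choose_two {ι : Type*} (T : Finset ι) (f : ι → ℕ) :
    ((T ×ˢ T).filter fun p => f p.1 < f p.2).card ≤ T.card.choose 2 := by
  classical
  rw [← Finset.card_powersetCard]
  refine Finset.card_le_card_of_injOn (fun p => {p.1, p.2}) (fun p hp => ?_) ?_
  · obtain ⟨hp, hlt⟩ := Finset.mem_filter.1 (Finset.mem_coe.1 hp)
    obtain ⟨h1, h2⟩ := Finset.mem_product.1 hp
    refine Finset.mem_coe.2 (Finset.mem_powersetCard.2 ⟨?_, Finset.card_pair ?_⟩)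
    · intro a ha
      rcases Finset.mem_insert.1 ha with rfl | ha
      · exact h1
      · exact Finset.mem_singleton.1 ha ▸ h2
    · intro h
      rw [h] at hlt
      exact lt_irrefl _ hlt
  · rintro ⟨a, b⟩ hp ⟨c, e⟩ hq h
    replace h : ({a, b} : Finset ι) = {c, e} := h
    have h1 : f a < f b := (Finset.mem_filter.1 (Finset.mem_coe.1 hp)).2
    have h2 : f c < f e := (Finset.mem_filter.1 (Finset.mem_coe.1 hq)).2
    have ha : a ∈ ({c, e} : Finset ι) := h ▸ Finset.mem_insert_self _ _
    have hb : b ∈ ({c, e} : Finset ι) :=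
      h ▸ Finset.mem_insert_of_mem (Finset.mem_singleton_self _)
    simp only [Finset.mem_insert, Finset.mem_singleton] at ha hb
    rcases ha with rfl | rfl <;> rcases hb with rfl | rfl
    · exact absurd h1 (lt_irrefl _)
    · rfl
    · exact absurd h1 h2.not_gt
    · exact absurd h1 (lt_irrefl _)

open Classical in
/-- For a simplex `T` inside `X`, all sums of a point of `X ∩ conv T` and a vertex are distinct,
except for the coincidences `s + t = t + s`. -/
theorem exists_injOn_pairs_simplex [FiniteDimensional ℝ E] {X T : Finset E}
    (hind : AffineIndependent ℝ (Subtype.val : T → E)) (hspan : affineSpan ℝ (T : Set E) = ⊤) :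
    ∃ R : Finset (E × E), (∀ p ∈ R, p.1 ∈ X ∧ SharesCell T 0 p.1 p.2) ∧
      Set.InjOn (fun p : E × E => p.1 + p.2) R ∧
      (Module.finrank ℝ E + 1) * (X.filter fun x => x ∈ convexHull ℝ (T : Set E)).card ≤
        R.card + (Module.finrank ℝ E + 1).choose 2 := by
  obtain ⟨f, hf⟩ := Set.countable_iff_exists_injOn.1 T.countable_toSet
  have hcard : T.card = Module.finrank ℝ E + 1 := by
    rw [← (hind.affineSpan_eq_top_iff_card_eq_finrank_add_one).1
      (by rw [Subtype.range_coe_subtype]; simpa using hspan), Fintype.card_coe]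
  set Y := X.filter fun x => x ∈ convexHull ℝ (T : Set E) with hY
  -- `D` contains exactly one of the two orderings of each pair of distinct vertices.
  set D := (T ×ˢ T).filter fun p : E × E => f p.1 < f p.2 with hD
  have hmem : ∀ p ∈ (Y ×ˢ T) \ D, p.1 ∈ X ∧ SharesCell T 0 p.1 p.2 := fun p hp => by
    obtain ⟨h1, h2⟩ := Finset.mem_product.1 (Finset.mem_sdiff.1 hp).1
    obtain ⟨h3, h4⟩ := Finset.mem_filter.1 h1
    exact ⟨h3, sharesCell_zero hspan h4 h2⟩
  refine ⟨(Y ×ˢ T) \ D, hmem, ?_, ?_⟩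
  · rintro ⟨x, s⟩ hp ⟨x', s'⟩ hq h
    have hc := (hmem _ hp).2
    have hc' := (hmem _ hq).2
    rcases (genericHeights_zero_of_affineIndependent hind).eq_or_swap hc hc' h with
      ⟨h1, h2⟩ | ⟨h1, h2⟩
    · exact Prod.ext h1 h2
    · dsimp only at h1 h2
      subst h1 h2
      have hs := hc.right_mem
      have hx := hc'.right_mem
      dsimp only at hs hx
      have n1 : ¬ f x < f x' := fun hlt => (Finset.mem_sdiff.1 hp).2
        (Finset.mem_filter.2 ⟨Finset.mem_product.2 ⟨hx, hs⟩, hlt⟩)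
      have n2 : ¬ f x' < f x := fun hlt => (Finset.mem_sdiff.1 hq).2
        (Finset.mem_filter.2 ⟨Finset.mem_product.2 ⟨hs, hx⟩, hlt⟩)
      have := hf hx hs (by omega)
      rw [this]
  · have h1 : D.card ≤ (Module.finrank ℝ E + 1).choose 2 := hcard ▸ card_filter_lt_le_choose_two T f
    have h2 := Finset.le_card_sdiff D (Y ×ˢ T)
    rw [Finset.card_product, hcard, mul_comm] at h2
    omega

-- The deficit comes from the simplex `T` alone and does not grow with `U`; genericity is carried
-- along for the induction.
open Classical in
theorem exists_injOn_pairs [FiniteDimensional ℝ E] {X T : Finset E}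
    (hind : AffineIndependent ℝ (Subtype.val : T → E)) (hspan : affineSpan ℝ (T : Set E) = ⊤)
    (U : Finset E) :
    ∃ (w : E → ℝ) (R : Finset (E × E)), GenericHeights (T ∪ U) w ∧
      (∀ p ∈ R, p.1 ∈ X ∧ SharesCell (T ∪ U) w p.1 p.2) ∧
      Set.InjOn (fun p : E × E => p.1 + p.2) R ∧
      (Module.finrank ℝ E + 1) *
          (X.filter fun x => x ∈ convexHull ℝ ((T ∪ U : Finset E) : Set E)).card ≤
        R.card + (Module.finrank ℝ E + 1).choose 2 := by
  induction U using Finset.induction_on with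
  | empty =>
    rw [Finset.union_empty]
    obtain ⟨R, hR⟩ := exists_injOn_pairs_simplex (X := X) hind hspan
    exact ⟨0, R, genericHeights_zero_of_affineIndependent hind, hR⟩
  | insert v U _ ih =>
    rw [Finset.union_insert]
    by_cases hv : v ∈ T ∪ U
    · rwa [Finset.insert_eq_of_mem hv]
    set V := T ∪ U with hV
    obtain ⟨w, R, hw, hR, hinj, hcard⟩ := ih
    obtain ⟨w', hw', hcell⟩ := hw.exists_insert hv
    have hspan' : affineSpan ℝ ((insert v V : Finset E) : Set E) = ⊤ := by
      rw [eq_top_iff, ← hspan]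
      refine affineSpan_mono ℝ (Finset.coe_subset.2 ?_)
      exact Finset.subset_union_left.trans (Finset.subset_insert _ _)
    set N := X.filter fun x => x ∈ convexHull ℝ ((insert v V : Finset E) : Set E) ∧
      x ∉ convexHull ℝ (V : Set E) with hN
    choose! S hScard hS using fun (x : E) (hx : x ∈ convexHull ℝ ((insert v V : Finset E) : Set E))
      => exists_sharesCell w' hspan' hx
    set P := N.biUnion fun x => (S x).image fun s => (x, s) with hP
    have hPmem : ∀ p ∈ P, p.1 ∈ X ∧ p.1 ∉ convexHull ℝ (V : Set E) ∧
        SharesCell (insert v V) w' p.1 p.2 := by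
      intro p hp
      obtain ⟨x, hx, hp⟩ := Finset.mem_biUnion.1 hp
      obtain ⟨s, hs, rfl⟩ := Finset.mem_image.1 hp
      obtain ⟨h1, h2, h3⟩ := Finset.mem_filter.1 hx
      exact ⟨h1, h3, hS x h2 s hs⟩
    have hPcard : (Module.finrank ℝ E + 1) * N.card ≤ P.card := by
      rw [hP, Finset.card_biUnion, mul_comm, ← smul_eq_mul]
      · refine Finset.card_nsmul_le_sum _ _ _ fun x hx => ?_
        rw [Finset.card_image_of_injective _ (Prod.mk_right_injective x)]
        exact hScard x (Finset.mem_filter.1 hx).2.1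
      · intro x _ y _ hxy
        refine Finset.disjoint_left.2 fun p hp hq => ?_
        obtain ⟨s, _, rfl⟩ := Finset.mem_image.1 hp
        obtain ⟨t, _, ht⟩ := Finset.mem_image.1 hq
        exact hxy (congrArg Prod.fst ht).symm
    have hdisj : Disjoint R P := Finset.disjoint_left.2 fun p hp hq =>
      (hPmem p hq).2.1 (hR p hp).2.left_mem
    -- A swap between new pairs has both vertices outside the old hull, so both are `v` and the
    -- pairs coincide.
    have hnew : ∀ s, s ∈ insert v V → s ∉ convexHull ℝ (V : Set E) → s = v := fun s hs hn =>
      (Finset.mem_insert.1 hs).resolve_right fun h => hn (subset_convexHull ℝ _ h)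
    -- A swap would make the new point `q.1` an old vertex.
    have hcross : ∀ p ∈ R, ∀ q ∈ P, p.1 + p.2 ≠ q.1 + q.2 := by
      intro p hp q hq h
      obtain ⟨-, hq1, hqc⟩ := hPmem q hq
      rcases hw'.eq_or_swap (hcell _ _ (hR p hp).2) hqc h with ⟨h1, -⟩ | ⟨-, h2⟩
      · exact hq1 (h1 ▸ (hR p hp).2.left_mem)
      · exact hq1 (h2 ▸ subset_convexHull ℝ _ (hR p hp).2.right_mem)
    refine ⟨w', R ∪ P, hw', fun p hp => ?_, ?_, ?_⟩
    · rcases Finset.mem_union.1 hp with hp | hp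
      · exact ⟨(hR p hp).1, hcell _ _ (hR p hp).2⟩
      · exact ⟨(hPmem p hp).1, (hPmem p hp).2.2⟩
    · intro p hp q hq h
      rcases Finset.mem_union.1 hp with hp | hp <;> rcases Finset.mem_union.1 hq with hq | hq
      · exact hinj hp hq h
      · exact absurd h (hcross p hp q hq)
      · exact absurd h.symm (hcross q hq p hp)
      · obtain ⟨-, hp1, hpc⟩ := hPmem p hp
        obtain ⟨-, hq1, hqc⟩ := hPmem q hq
        rcases hw'.eq_or_swap hpc hqc h with ⟨h1, h2⟩ | ⟨h1, h2⟩
        · exact Prod.ext h1 h2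
        · have e1 := hnew _ (h1 ▸ hqc.right_mem) hp1
          have e2 := hnew _ (h2 ▸ hpc.right_mem) hq1
          exact Prod.ext (e1.trans e2.symm) (by rw [← h2, ← h1, e1, e2])
    · have hsplit : (X.filter fun x => x ∈ convexHull ℝ ((insert v V : Finset E) : Set E)).card ≤
          (X.filter fun x => x ∈ convexHull ℝ (V : Set E)).card + N.card := by
        refine le_trans (Finset.card_le_card fun x hx => ?_) (Finset.card_union_le _ _)
        obtain ⟨h1, h2⟩ := Finset.mem_filter.1 hx
        by_cases h : x ∈ convexHull ℝ (V : Set E)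
        · exact Finset.mem_union_left _ (Finset.mem_filter.2 ⟨h1, h⟩)
        · exact Finset.mem_union_right _ (Finset.mem_filter.2 ⟨h1, h2, h⟩)
      rw [Finset.card_union_of_disjoint hdisj]
      have := Nat.mul_le_mul_left (Module.finrank ℝ E + 1) hsplit
      rw [mul_add] at this
      omega

/-- If `X` lies in the convex hull of a finite set `V` spanning the space affinely, then `X + V`
is as large as in Freiman's lemma. -/
theorem finrank_add_one_mul_ncard_le_ncard_add [FiniteDimensional ℝ E] {X V : Set E}
    (hX : X.Finite) (hV : V.Finite) (hspan : affineSpan ℝ V = ⊤) (hXV : X ⊆ convexHull ℝ V) :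
    (Module.finrank ℝ E + 1) * X.ncard ≤ (X + V).ncard + (Module.finrank ℝ E + 1).choose 2 := by
  classical
  obtain ⟨T, hTV, hT, hind⟩ := exists_affineIndependent ℝ E V
  lift X to Finset E using hX
  lift V to Finset E using hV
  lift T to Finset E using V.finite_toSet.subset hTV
  rw [hspan] at hT
  obtain ⟨w, R, -, hR, hinj, hcard⟩ := exists_injOn_pairs (X := X) hind hT V
  rw [Finset.union_eq_right.2 (Finset.coe_subset.1 hTV), Finset.filter_true_of_mem hXV] at hcard
  rw [Finset.union_eq_right.2 (Finset.coe_subset.1 hTV)] at hR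
  have h : R.card ≤ (X + V).card := Finset.card_le_card_of_injOn _
    (fun p hp => Finset.add_mem_add (hR p hp).1 (hR p hp).2.right_mem) hinj
  rw [← Finset.coe_add, Set.ncard_coe_finset, Set.ncard_coe_finset]
  omega

/-! ### Vertices of `A` and conclusion -/

/-- By Krein–Milman it suffices that extreme points of the hull are vertices: removing one leaves a
convex set containing the rest of `A`. -/
theorem subset_convexHull_vert {d : ℕ} {A : Set (EuclideanSpace ℝ (Fin d))} (hA : A.Finite) :
    A ⊆ convexHull ℝ (vert A) := by
  have hsub : (convexHull ℝ A).extremePoints ℝ ⊆ vert A := fun a ha => by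
    refine ⟨extremePoints_convexHull_subset ha, fun h => ?_⟩
    have hconv := ((convex_convexHull ℝ A).mem_extremePoints_iff_convex_sdiff.1 ha).2
    refine (convexHull_min ?_ hconv h).2 rfl
    exact Set.sdiff_subset_sdiff_left (subset_convexHull ℝ A)
  have hfin : (vert A).Finite := hA.subset fun a ha => ha.1
  calc A ⊆ convexHull ℝ A := subset_convexHull ℝ A
    _ = closure (convexHull ℝ ((convexHull ℝ A).extremePoints ℝ)) :=
      (closure_convexHull_extremePoints (hA.isCompact_convexHull ℝ) (convex_convexHull ℝ A)).symm
    _ ⊆ convexHull ℝ (vert A) :=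
      closure_minimal (convexHull_mono hsub) (hfin.isClosed_convexHull ℝ)

theorem IsProperDim.affineSpan_eq_top {d : ℕ} {A : Set (EuclideanSpace ℝ (Fin d))}
    (hA : IsProperDim A) (hne : A.Nonempty) : affineSpan ℝ A = ⊤ := by
  obtain ⟨a, ha⟩ := hne
  rw [← AffineSubspace.direction_eq_top_iff_of_nonempty ⟨a, subset_affineSpan ℝ A ha⟩,
    direction_affineSpan]
  by_contra hlt
  obtain ⟨f, hf, hker⟩ := Submodule.exists_le_ker_of_lt_top _ (lt_top_iff_ne_top.2 hlt)
  refine hA f (f a) hf fun x hx => ?_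
  have : f (x - a) = 0 := hker (vsub_mem_vectorSpan ℝ hx ha)
  rw [map_sub, sub_eq_zero] at this
  exact this

theorem theorem2 (d m : ℕ) (A : Set (EuclideanSpace ℝ (Fin d))) (hfin : A.Finite)
    (hcard : A.ncard = m) (hA : IsProperDim A) :
    (m : ℝ) * ((d : ℝ) + 1) - (d : ℝ) * ((d : ℝ) + 1) / 2 ≤ ((A + vert A).ncard : ℝ) := by
  subst hcard
  -- The empty set is vacuously proper when `d = 0`, so it needs its own case.
  rcases A.eq_empty_or_nonempty with rfl | hne
  · simp only [Set.ncard_empty, Nat.cast_zero, zero_mul, zero_sub]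
    have : (0 : ℝ) ≤ (d : ℝ) * ((d : ℝ) + 1) / 2 := by positivity
    linarith [Nat.cast_nonneg (α := ℝ) ((∅ + vert (∅ : Set (EuclideanSpace ℝ (Fin d)))).ncard)]
  have hsub := subset_convexHull_vert hfin
  have hspan : affineSpan ℝ (vert A) = ⊤ := by
    rw [eq_top_iff, ← hA.affineSpan_eq_top hne, affineSpan_le]
    exact hsub.trans (convexHull_subset_affineSpan _)
  have h := finrank_add_one_mul_ncard_le_ncard_add hfin (hfin.subset fun a ha => ha.1) hspan hsub
  rw [finrank_euclideanSpace_fin] at h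
  have h' : ((d : ℝ) + 1) * A.ncard ≤ (A + vert A).ncard + ((d + 1).choose 2 : ℕ) := by
    exact_mod_cast h
  rw [Nat.cast_choose_two, Nat.cast_add, Nat.cast_one] at h'
  linarith
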